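/- Let $(\Omega,\Sigma,\mathbb{P})$ be a probability space, let $L^0$ be the ordered ring of real-valued random variables and $\bar{L^0}$ the set of $[-\infty,+\infty]$-valued random variables, both modulo almost sure equality. All inequalities are understood almost surely; in particular $\eta>0$ means that $\eta$ is almost surely strictly positive. $L^0$ carries the topology of almost sure dominance, in which the sets $\{y\in L^0:|y-x|<\varepsilon\}$ with $\varepsilon\in L^0$, $\varepsilon>0$, form a neighborhood base at $x$. A partition $\{A_k\}$ is a countable family of pairwise disjoint events covering $\Omega$ (up to null sets; null members are allowed). Let $E$ be an $L^0$-module with the countable concatenation property: for every sequence $(x_k)$ in $E$ and every partition $\{A_k\}$ there is a unique $x\in E$, written $\sum 1_{A_k}x_k$, such that $1_{A_k}x=1_{A_k}x_k$ for all $k$. A set $S\subset E$ is - stable if it is nonempty and $\sum 1_{A_k}x_k\in S$ for all $(x_k)\subset S$ and all partitions $\{A_k\}$; - $L^0$-convex if $\eta x+(1-\eta)y\in S$ for all $x,y\in S$ and $\eta\in L^0$ with $0\le\eta\le1$; - $L^0$-absorbing if for every $x\in E$ there is $\eta\in L^0$, $\eta>0$, with $x\in\eta S$; - $L^0$-balanced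 if $\eta x\in S$ for all $x\in S$ and $\eta\in L^0$ with $|\eta|\le 1$. A nonempty collection $\mathscr{C}$ of subsets of $E$ is stable if all its members are stable and $\sum 1_{A_k}S_k:=\{\sum 1_{A_k}x_k: x_k\in S_k\}\in\mathscr{C}$ for all sequences $(S_k)$ in $\mathscr{C}$ and all partitions $\{A_k\}$. Suppose that $E$ carries a topology for which addition $E\times E\to E$ and scalar multiplication $L^0\times E\to E$ are continuous and $0$ has a neighborhood base that is a stable collection of $L^0$-convex, $L^0$-absorbing and $L^0$-balanced sets (that is, $E$ is a stable locally $L^0$-convex module). Suppose also that $E$ is stably barreled: every stable, $L^0$-convex, $L^0$-absorbing, $L^0$-balanced and closed subset of $E$ is a neighborhood of $0$. Let $f:E\to\bar{L^0}$ be a function with domain $\mathrm{dom}(f)=\{x\in E: f(x)\in L^0\}$ which is - proper: $f(x)>-\infty$ for all $x\in E$, and $\mathrm{dom}(f)\neq\emptyset$; - lower semicontinuous: $\{x\in E:f(x)\le\eta\}$ is closed for every $\eta\in\bar{L^0}$; - $L^0$-convex: $f(\eta x+(1-\eta)y)\le\eta f(x)+(1-\eta)f(y)$ for all $x,y\in E$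 and $\eta\in L^0$ with $0\le\eta\le1$, where $0\cdot(\pm\infty)=0$. **Theorem.** For every $x_0$ in the interior of $\mathrm{dom}(f)$ the subdifferential $\partial f(x_0)$ is nonempty; that is, there is a continuous $L^0$-module morphism $\mu:E\to L^0$ such that $$\mu(x-x_0)\le f(x)-f(x_0)\quad\text{for all }x\in E.$$ -/

import Mathlib

open MeasureTheory Filter Topology
open scoped Pointwise

noncomputable section L0Modules

variable {Ω : Type*} [MeasurableSpace Ω]

/-- The space `L⁰(Ω, Σ, P)` of real random variables modulo almost sure equality. -/
abbrev L0 (P : Measure Ω) : Type _ := Ω →ₘ[P] ℝ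

/-- The space of `[-∞, +∞]`-valued random variables modulo almost sure equality. -/
abbrev L0Bar (P : Measure Ω) : Type _ := Ω →ₘ[P] EReal

/-- `L⁰` is a commutative ring under the almost sure pointwise operations. -/
instance L0.instCommRing (P : Measure Ω) : CommRing (L0 P) :=
  { (inferInstance : AddCommGroup (L0 P)), (inferInstance : CommMonoid (L0 P)) with
    left_distrib := fun a b c => by
      induction a using AEEqFun.induction_on
      induction b using AEEqFun.induction_on
      induction c using AEEqFun.induction_on
      simp only [AEEqFun.mk_add_mk, AEEqFun.mk_mul_mk, mul_add]
    right_distrib := fun a b c => by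
      induction a using AEEqFun.induction_on
      induction b using AEEqFun.induction_on
      induction c using AEEqFun.induction_on
      simp only [AEEqFun.mk_add_mk, AEEqFun.mk_mul_mk, add_mul]
    zero_mul := fun a => by
      induction a using AEEqFun.induction_on
      simp only [AEEqFun.zero_def, AEEqFun.mk_mul_mk, Pi.mul_def, zero_mul]
    mul_zero := fun a => by
      induction a using AEEqFun.induction_on
      simp only [AEEqFun.zero_def, AEEqFun.mk_mul_mk, Pi.mul_def, mul_zero] }

/-- Strict positivity in `L⁰`: `η > 0` almost surely. -/
def L0.Pos {P : Measure Ω} (η : L0 P) : Prop := ∀ᵐ ω ∂P, 0 < η ω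

/-- The topology of almost sure dominance on `L⁰`: the balls
`{y : |y - x| < ε almost surely}`, with `ε ∈ L⁰` almost surely positive, form a neighbourhood
base at `x`. -/
instance L0.instTopologicalSpace (P : Measure Ω) : TopologicalSpace (L0 P) where
  IsOpen U := ∀ x ∈ U, ∃ ε : L0 P, ε.Pos ∧ ∀ y : L0 P, (ε - |y - x|).Pos → y ∈ U
  isOpen_univ := fun _ _ => ⟨1, by
    filter_upwards [AEEqFun.coeFn_one (μ := P) (β := ℝ)] with ω h
    simp [h], fun _ _ => Set.mem_univ _⟩
  isOpen_inter := by
    rintro U V hU hV x ⟨hxU, hxV⟩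
    obtain ⟨ε, hε, hεU⟩ := hU x hxU
    obtain ⟨δ, hδ, hδV⟩ := hV x hxV
    refine ⟨ε ⊓ δ, ?_, fun y hy => ⟨hεU y ?_, hδV y ?_⟩⟩
    · filter_upwards [hε, hδ, AEEqFun.coeFn_inf ε δ] with ω h1 h2 h3
      rw [h3]
      exact lt_min h1 h2
    · filter_upwards [hy, AEEqFun.coeFn_inf ε δ, AEEqFun.coeFn_sub (ε ⊓ δ) |y - x|,
        AEEqFun.coeFn_sub ε |y - x|] with ω h1 h2 h3 h4
      rw [h3, Pi.sub_apply, h2] at h1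
      rw [h4, Pi.sub_apply]
      linarith [min_le_left (ε ω) (δ ω)]
    · filter_upwards [hy, AEEqFun.coeFn_inf ε δ, AEEqFun.coeFn_sub (ε ⊓ δ) |y - x|,
        AEEqFun.coeFn_sub δ |y - x|] with ω h1 h2 h3 h4
      rw [h3, Pi.sub_apply, h2] at h1
      rw [h4, Pi.sub_apply]
      linarith [min_le_right (ε ω) (δ ω)]
  isOpen_sUnion := by
    rintro 𝒮 h𝒮 x ⟨U, hU, hxU⟩
    obtain ⟨ε, hε, hεU⟩ := h𝒮 U hU x hxU
    exact ⟨ε, hε, fun y hy => ⟨U, hU, hεU y hy⟩⟩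

/-- The element `1_A` of `L⁰`. -/
def L0.ind (P : Measure Ω) (A : Set Ω) (hA : MeasurableSet A) : L0 P :=
  AEEqFun.mk (A.indicator fun _ => (1 : ℝ)) (aestronglyMeasurable_const.indicator hA)

/-- A countable partition of `Ω` in the measure algebra of `P` (null pieces are allowed, so that
finite partitions are included). -/
structure CountablePartition (P : Measure Ω) where
  piece : ℕ → Set Ω
  measurableSet_piece : ∀ k, MeasurableSet (piece k)
  aedisjoint : Pairwise fun i j => AEDisjoint P (piece i) (piece j)
  ae_mem_iUnion : ∀ᵐ ω ∂P, ω ∈ ⋃ k, piece k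

/-- The element `1_{A_k}` of `L⁰` for the `k`-th piece of a partition. -/
def CountablePartition.ind {P : Measure Ω} (A : CountablePartition P) (k : ℕ) : L0 P :=
  L0.ind P (A.piece k) (A.measurableSet_piece k)

section Algebra

variable {E : Type*} [AddCommGroup E]

/-- `x` is a concatenation of the sequence `u` along the partition `A`, that is,
`1_{A_k} x = 1_{A_k} u_k` for all `k`. -/
def IsConcat {P : Measure Ω} [Module (L0 P) E] (A : CountablePartition P) (u : ℕ → E) (x : E) :
    Prop :=
  ∀ k, A.ind k • x = A.ind k • u k

/-- The countable concatenation property of an `L⁰`-module. -/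
def HasConcat (P : Measure Ω) (E : Type*) [AddCommGroup E] [Module (L0 P) E] : Prop :=
  ∀ (A : CountablePartition P) (u : ℕ → E), ∃! x : E, IsConcat A u x

variable (P : Measure Ω) [Module (L0 P) E]

/-- A stable set: nonempty and closed under countable concatenations. -/
def IsStableSet (S : Set E) : Prop :=
  S.Nonempty ∧ ∀ (A : CountablePartition P) (u : ℕ → E), (∀ k, u k ∈ S) →
    ∀ x, IsConcat A u x → x ∈ S

/-- The set `∑ 1_{A_k} S_k` of all concatenations `∑ 1_{A_k} u_k` with `u_k ∈ S_k`. -/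
def concatSets {P : Measure Ω} [Module (L0 P) E] (A : CountablePartition P) (S : ℕ → Set E) :
    Set E :=
  {x | ∃ u : ℕ → E, (∀ k, u k ∈ S k) ∧ IsConcat A u x}

/-- A stable collection of subsets. -/
def IsStableCollection (𝒞 : Set (Set E)) : Prop :=
  𝒞.Nonempty ∧ (∀ S ∈ 𝒞, IsStableSet P S) ∧
    ∀ (A : CountablePartition P) (S : ℕ → Set E), (∀ k, S k ∈ 𝒞) → concatSets A S ∈ 𝒞

def IsL0Convex (S : Set E) : Prop :=
  ∀ x ∈ S, ∀ y ∈ S, ∀ η : L0 P, 0 ≤ η → η ≤ 1 → η • x + (1 - η) • y ∈ S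

def IsL0Absorbing (S : Set E) : Prop :=
  ∀ x : E, ∃ η : L0 P, η.Pos ∧ x ∈ η • S

def IsL0Balanced (S : Set E) : Prop :=
  ∀ x ∈ S, ∀ η : L0 P, |η| ≤ 1 → η • x ∈ S

end Algebra

/-- A stable locally `L⁰`-convex module: a topological `L⁰`-module with the countable
concatenation property whose origin has a neighbourhood base that is a stable collection of
`L⁰`-convex, `L⁰`-absorbing and `L⁰`-balanced sets. -/
structure IsStableLocallyL0Convex (P : Measure Ω) (E : Type*) [AddCommGroup E] [Module (L0 P) E]
    [TopologicalSpace E] : Prop where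
  continuousAdd : ContinuousAdd E
  continuousSMul : ContinuousSMul (L0 P) E
  hasConcat : HasConcat P E
  exists_basis : ∃ 𝒰 : Set (Set E), (𝓝 (0 : E)).HasBasis (fun U => U ∈ 𝒰) id ∧
    IsStableCollection P 𝒰 ∧
    ∀ U ∈ 𝒰, IsL0Convex P U ∧ IsL0Absorbing P U ∧ IsL0Balanced P U

section Topological

variable (P : Measure Ω) {E : Type*} [AddCommGroup E] [Module (L0 P) E] [TopologicalSpace E]

structure IsL0Barrel (S : Set E) : Prop where
  convex : IsL0Convex P S
  absorbing : IsL0Absorbing P S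
  balanced : IsL0Balanced P S
  isClosed : IsClosed S

/-- Every stable `L⁰`-barrel is a neighbourhood of the origin. -/
def IsStablyBarreled (E : Type*) [AddCommGroup E] [Module (L0 P) E] [TopologicalSpace E] : Prop :=
  ∀ S : Set E, IsStableSet P S → IsL0Barrel P S → S ∈ 𝓝 (0 : E)

end Topological

section Functions

variable {P : Measure Ω} {E : Type*} [AddCommGroup E] [Module (L0 P) E]

/-- The inclusion of `L⁰` in the extended random variables. -/
def L0.toBar (η : L0 P) : L0Bar P :=
  AEEqFun.comp (fun r : ℝ => (r : EReal)) continuous_coe_real_ereal η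

/-- The domain of `f`: the points where `f` takes a value in `L⁰`. -/
def effDom (f : E → L0Bar P) : Set E := {x | ∃ η : L0 P, f x = η.toBar}

/-- `f > -∞` (almost surely) everywhere, and `f` takes a value in `L⁰` somewhere. -/
def IsProperFun (f : E → L0Bar P) : Prop :=
  (∀ x, ∀ᵐ ω ∂P, ⊥ < f x ω) ∧ (effDom f).Nonempty

/-- `f (η x + (1 - η) y) ≤ η f(x) + (1 - η) f(y)` almost surely; in `EReal`, as usual,
`0 * ⊤ = 0`. -/
def IsL0ConvexFun (f : E → L0Bar P) : Prop :=
  ∀ (x y : E) (η : L0 P), 0 ≤ η → η ≤ 1 →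
    ∀ᵐ ω ∂P, f (η • x + (1 - η) • y) ω ≤
      ((η ω : ℝ) : EReal) * f x ω + ((1 - η ω : ℝ) : EReal) * f y ω

/-- All sublevel sets of `f` are closed. -/
def IsL0LowerSemicontinuous [TopologicalSpace E] (f : E → L0Bar P) : Prop :=
  ∀ η : L0Bar P, IsClosed {x | f x ≤ η}

/-- The set of subgradients of `f` at `x₀ ∈ dom f`: the continuous `L⁰`-module morphisms `μ` with
`μ (x - x₀) ≤ f x - f x₀` almost surely, for all `x`. -/
def l0Subdifferential [TopologicalSpace E] (f : E → L0Bar P) (x₀ : E) : Set (E →L[L0 P] L0 P) :=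
  {μ | x₀ ∈ effDom f ∧
    ∀ x : E, ∀ᵐ ω ∂P, ((μ (x - x₀) ω : ℝ) : EReal) ≤ f x ω - f x₀ ω}

end Functions

end L0Modules

/-! ### Order structure and Dedekind completeness of `L⁰` -/

namespace L0

variable {Ω : Type*} [MeasurableSpace Ω] {P : Measure Ω}

/-! With `c = f x₀`, the difference quotients `(f (x₀ + l y) - c) / l`, `l > 0`, have an infimum in
`L⁰`: the directional derivative at `x₀`. It exists because `L⁰` is Dedekind complete
(`L0.exists_isGLB`) and `f` is finite around `x₀` in every direction. It is sublinear in `y`, so a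
Hahn-Banach argument (`exists_l0LinearMap_le`) puts an `L⁰`-linear `μ` below it. Scalars need not be
invertible, so one-step extension is avoided: Zorn's lemma gives a minimal sublinear function, and
minimality forces linearity.

Continuity comes from barreledness. The set of `y` with `f (x₀ ± y) ≤ c + 1` is a stable barrel,
hence a neighbourhood of `0`, and `|μ| ≤ 1` on it. Locality of `L⁰`-convex functions makes this set
stable, and it also extends the subgradient inequality to points where `f` is `+∞` on part of `Ω`.
-/

instance instIsOrderedAddMonoid : IsOrderedAddMonoid (L0 P) where
  add_le_add_left a b h c := by
    rw [← AEEqFun.coeFn_le] at h ⊢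
    filter_upwards [h, AEEqFun.coeFn_add a c, AEEqFun.coeFn_add b c] with ω h h1 h2
    simpa [h1, h2] using h

instance instIsOrderedRing : IsOrderedRing (L0 P) where
  zero_le_one := by
    rw [← AEEqFun.coeFn_le]
    filter_upwards [AEEqFun.coeFn_zero (μ := P) (β := ℝ), AEEqFun.coeFn_one (μ := P) (β := ℝ)]
      with ω h1 h2
    simp [h1, h2]
  mul_le_mul_of_nonneg_left c hc a b h := by
    rw [← AEEqFun.coeFn_le] at h hc ⊢
    filter_upwards [h, hc, AEEqFun.coeFn_mul c a, AEEqFun.coeFn_mul c b,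
      AEEqFun.coeFn_zero (μ := P) (β := ℝ)] with ω h hc h1 h2 h0
    rw [h0] at hc
    simpa [h1, h2] using mul_le_mul_of_nonneg_left h hc
  mul_le_mul_of_nonneg_right c hc a b h := by
    rw [← AEEqFun.coeFn_le] at h hc ⊢
    filter_upwards [h, hc, AEEqFun.coeFn_mul a c, AEEqFun.coeFn_mul b c,
      AEEqFun.coeFn_zero (μ := P) (β := ℝ)] with ω h hc h1 h2 h0
    rw [h0] at hc
    simpa [h1, h2] using mul_le_mul_of_nonneg_right h hc

theorem Pos.nonneg {η : L0 P} (h : η.Pos) : 0 ≤ η := by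
  rw [← AEEqFun.coeFn_le]
  filter_upwards [h, AEEqFun.coeFn_zero (μ := P) (β := ℝ)] with ω h h0
  rw [h0]
  exact h.le

theorem pos_one : (1 : L0 P).Pos := by
  filter_upwards [AEEqFun.coeFn_one (μ := P) (β := ℝ)] with ω h
  simp [h]

theorem Pos.add_nonneg {a b : L0 P} (ha : a.Pos) (hb : 0 ≤ b) : (a + b).Pos := by
  rw [← AEEqFun.coeFn_le] at hb
  filter_upwards [ha, hb, AEEqFun.coeFn_add a b, AEEqFun.coeFn_zero (μ := P) (β := ℝ)]
    with ω ha hb h h0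
  rw [h0] at hb
  rw [h]
  exact add_pos_of_pos_of_nonneg ha hb

theorem Pos.mul {a b : L0 P} (ha : a.Pos) (hb : b.Pos) : (a * b).Pos := by
  filter_upwards [ha, hb, AEEqFun.coeFn_mul a b] with ω ha hb h
  rw [h]
  exact mul_pos ha hb

theorem Pos.exists_inv {η : L0 P} (h : η.Pos) : ∃ θ : L0 P, θ.Pos ∧ η * θ = 1 := by
  have hθ := AEEqFun.coeFn_compMeasurable (fun r : ℝ => r⁻¹) measurable_inv η
  refine ⟨AEEqFun.compMeasurable (fun r : ℝ => r⁻¹) measurable_inv η, ?_, ?_⟩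
  · filter_upwards [h, hθ] with ω h h1
    rw [h1]
    exact inv_pos.2 h
  · refine AEEqFun.ext ?_
    filter_upwards [h, hθ, AEEqFun.coeFn_mul η (AEEqFun.compMeasurable (fun r : ℝ => r⁻¹)
      measurable_inv η), AEEqFun.coeFn_one (μ := P) (β := ℝ)] with ω h h1 h2 h3
    rw [h2, h3, Pi.mul_apply, h1]
    exact mul_inv_cancel₀ h.ne'

/-- A sequence bounded below has an almost sure infimum. -/
theorem exists_isGLB_range (u : ℕ → L0 P) (hu : BddBelow (Set.range u)) :
    ∃ g, IsGLB (Set.range u) g := by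
  obtain ⟨b, hb⟩ := hu
  have hb' : ∀ᵐ ω ∂P, ∀ n, b ω ≤ u n ω :=
    ae_all_iff.2 fun n => AEEqFun.coeFn_le.2 (hb ⟨n, rfl⟩)
  have hm : Measurable fun ω => ⨅ n, u n ω :=
    Measurable.iInf fun n => (AEEqFun.stronglyMeasurable (u n)).measurable
  refine ⟨AEEqFun.mk _ hm.aestronglyMeasurable, ?_, ?_⟩
  · rintro _ ⟨n, rfl⟩
    rw [← AEEqFun.coeFn_le]
    filter_upwards [hb', AEEqFun.coeFn_mk _ hm.aestronglyMeasurable] with ω h h1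
    rw [h1]
    exact ciInf_le ⟨b ω, by rintro _ ⟨n, rfl⟩; exact h n⟩ n
  · intro c hc
    have hc' : ∀ᵐ ω ∂P, ∀ n, c ω ≤ u n ω :=
      ae_all_iff.2 fun n => AEEqFun.coeFn_le.2 (hc ⟨n, rfl⟩)
    rw [← AEEqFun.coeFn_le]
    filter_upwards [hc', AEEqFun.coeFn_mk _ hm.aestronglyMeasurable] with ω h h1
    rw [h1]
    exact le_ciInf h

theorem integrable_arctan [IsFiniteMeasure P] (g : L0 P) :
    Integrable (fun ω => Real.arctan (g ω)) P := by
  refine Integrable.of_bound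
    (Real.continuous_arctan.comp_aestronglyMeasurable g.aestronglyMeasurable) (Real.pi / 2) ?_
  filter_upwards with ω
  rw [Real.norm_eq_abs, abs_le]
  exact ⟨(Real.neg_pi_div_two_lt_arctan _).le, (Real.arctan_lt_pi_div_two _).le⟩

theorem integral_arctan_mono [IsFiniteMeasure P] {g h : L0 P} (hgh : g ≤ h) :
    ∫ ω, Real.arctan (g ω) ∂P ≤ ∫ ω, Real.arctan (h ω) ∂P := by
  refine integral_mono_ae (integrable_arctan g) (integrable_arctan h) ?_
  filter_upwards [AEEqFun.coeFn_le.2 hgh] with ω h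
  exact Real.arctan_strictMono.monotone h

/-- Since `arctan` is bounded and strictly increasing, `g ↦ ∫ arctan g` is finite on all of `L⁰` and
strictly monotone. An infimum in `L⁰` can therefore be found by minimising a real number. -/
theorem eq_of_integral_arctan_le [IsFiniteMeasure P] {g h : L0 P} (hgh : g ≤ h)
    (hi : ∫ ω, Real.arctan (h ω) ∂P ≤ ∫ ω, Real.arctan (g ω) ∂P) : g = h := by
  have hle : (fun ω => Real.arctan (g ω)) ≤ᵐ[P] fun ω => Real.arctan (h ω) := by
    filter_upwards [AEEqFun.coeFn_le.2 hgh] with ω h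
    exact Real.arctan_strictMono.monotone h
  have := (integral_eq_iff_of_ae_le (integrable_arctan g) (integrable_arctan h) hle).1
    (le_antisymm (integral_arctan_mono hgh) hi)
  refine AEEqFun.ext ?_
  filter_upwards [this] with ω h
  exact Real.arctan_injective h

/-- `L⁰` is Dedekind complete. -/
theorem exists_isGLB [IsFiniteMeasure P] {S : Set (L0 P)} (hne : S.Nonempty) (hS : BddBelow S) :
    ∃ g, IsGLB S g := by
  have hbdd : ∀ u : ℕ → S, BddBelow (Set.range fun n => (u n : L0 P)) := fun u =>
    hS.mono (by rintro _ ⟨n, rfl⟩; exact (u n).2)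
  choose G hG using fun u : ℕ → S => exists_isGLB_range (fun n => (u n : L0 P)) (hbdd u)
  set J : Set ℝ := Set.range fun u : ℕ → S => ∫ ω, Real.arctan (G u ω) ∂P with hJ
  obtain ⟨s₀, hs₀⟩ := hne
  have hJne : J.Nonempty := ⟨_, fun _ => ⟨s₀, hs₀⟩, rfl⟩
  obtain ⟨b, hb⟩ := hS
  have hJb : BddBelow J := by
    refine ⟨∫ ω, Real.arctan (b ω) ∂P, ?_⟩
    rintro _ ⟨u, rfl⟩
    refine integral_arctan_mono ((hG u).2 ?_)
    rintro _ ⟨n, rfl⟩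
    exact hb (u n).2
  have happrox : ∀ n : ℕ, ∃ u : ℕ → S,
      ∫ ω, Real.arctan (G u ω) ∂P < sInf J + 1 / ((n : ℝ) + 1) := fun n => by
    obtain ⟨_, ⟨u, rfl⟩, h⟩ := exists_lt_of_csInf_lt hJne
      (lt_add_of_pos_right (sInf J) (Nat.one_div_pos_of_nat (α := ℝ) (n := n)))
    exact ⟨u, h⟩
  choose u hu using happrox
  -- Merging the sequences `u n` into one gives a countable infimum below every `G (u n)`, so `G v`
  -- attains `sInf J`.
  set v : ℕ → S := fun k => u k.unpair.1 k.unpair.2 with hv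
  have hvu : ∀ n, G v ≤ G (u n) := fun n => (hG (u n)).2 (by
    rintro _ ⟨k, rfl⟩
    exact (hG v).1 ⟨Nat.pair n k, by simp [hv]⟩)
  have hvmin : ∫ ω, Real.arctan (G v ω) ∂P ≤ sInf J := by
    refine le_of_forall_pos_le_add fun ε hε => ?_
    obtain ⟨n, hn⟩ := exists_nat_one_div_lt hε
    linarith [hu n, integral_arctan_mono (hvu n)]
  refine ⟨G v, fun s hs => ?_, fun c hc => (hG v).2 (by
    rintro _ ⟨n, rfl⟩
    exact hc (v n).2)⟩
  -- Prepending `s` to `v` cannot lower the minimal integral, so `G w = G v` and hence `G v ≤ s`.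
  set w : ℕ → S := fun k => Nat.casesOn k ⟨s, hs⟩ v with hw
  have hwv : G w ≤ G v := (hG v).2 (by
    rintro _ ⟨k, rfl⟩
    exact (hG w).1 ⟨k + 1, rfl⟩)
  have := eq_of_integral_arctan_le hwv (hvmin.trans (csInf_le hJb ⟨w, rfl⟩))
  rw [← this]
  exact (hG w).1 ⟨0, rfl⟩

end L0

/-! ### Sublinear functions and Hahn-Banach over `L⁰` -/

section HahnBanach

variable {Ω : Type*} [MeasurableSpace Ω] {P : Measure Ω}
  {E : Type*} [AddCommGroup E] [Module (L0 P) E]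

/-- A sublinear function on an `L⁰`-module, homogeneous for strictly positive scalars. -/
structure IsL0Sublinear (q : E → L0 P) : Prop where
  add_le : ∀ x y, q (x + y) ≤ q x + q y
  smul_le : ∀ η : L0 P, η.Pos → ∀ x, q (η • x) ≤ η * q x

namespace IsL0Sublinear

variable {q : E → L0 P}

/-- A strictly positive scalar has a strictly positive inverse, and the inequality for the inverse
is the reverse one. -/
theorem map_smul (hq : IsL0Sublinear q) {η : L0 P} (hη : η.Pos) (x : E) :
    q (η • x) = η * q x := by
  refine le_antisymm (hq.smul_le η hη x) ?_
  obtain ⟨θ, hθ, h⟩ := hη.exists_inv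
  have h1 := mul_le_mul_of_nonneg_left (hq.smul_le θ hθ (η • x)) hη.nonneg
  rwa [smul_smul, mul_comm θ η, h, one_smul, ← mul_assoc, h, one_mul] at h1

theorem map_zero (hq : IsL0Sublinear q) : q 0 = 0 := by
  have h := hq.map_smul (L0.pos_one.add_nonneg L0.pos_one.nonneg) (0 : E)
  rw [smul_zero, add_mul, one_mul] at h
  exact left_eq_add.1 h

end IsL0Sublinear

/-- The lower envelope of a convex cone in `E × L⁰` is sublinear. -/
theorem exists_isL0Sublinear_isGLB [IsFiniteMeasure P] (T : E → Set (L0 P))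
    (hne : ∀ y, (T y).Nonempty)
    (hadd : ∀ y z, ∀ a ∈ T y, ∀ b ∈ T z, a + b ∈ T (y + z))
    (hsmul : ∀ η : L0 P, η.Pos → ∀ y, ∀ a ∈ T y, η * a ∈ T (η • y))
    (hzero : ∀ a ∈ T 0, 0 ≤ a) :
    ∃ q : E → L0 P, IsL0Sublinear q ∧ ∀ y, IsGLB (T y) (q y) := by
  have hb : ∀ y, BddBelow (T y) := fun y => by
    obtain ⟨b, hb⟩ := hne (-y)
    refine ⟨-b, fun a ha => ?_⟩
    have := hadd y (-y) a ha b hb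
    rw [add_neg_cancel] at this
    exact neg_le_iff_add_nonneg.2 (hzero _ this)
  choose q hq using fun y => L0.exists_isGLB (hne y) (hb y)
  refine ⟨q, ⟨fun y z => ?_, fun η hη y => ?_⟩, hq⟩
  · rw [← sub_le_iff_le_add]
    refine (hq y).2 fun a ha => ?_
    rw [sub_le_comm]
    refine (hq z).2 fun b hb => ?_
    rw [sub_le_iff_le_add']
    exact (hq _).1 (hadd y z a ha b hb)
  · obtain ⟨θ, hθ, h⟩ := hη.exists_inv
    have h1 : θ * q (η • y) ≤ q y := (hq y).2 fun a ha => by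
      have := mul_le_mul_of_nonneg_left ((hq _).1 (hsmul η hη y a ha)) hθ.nonneg
      rwa [← mul_assoc, mul_comm θ η, h, one_mul] at this
    have h2 := mul_le_mul_of_nonneg_left h1 hη.nonneg
    rwa [← mul_assoc, h, one_mul] at h2

/-- Zorn's lemma in the reversed order: a nonempty chain has its pointwise infimum as a sublinear
lower bound. Comparability within the chain gives subadditivity, and vanishing at `0` keeps the
infimum finite. -/
theorem IsL0Sublinear.exists_minimal [IsFiniteMeasure P] {p : E → L0 P} (hp : IsL0Sublinear p) :
    ∃ m ≤ p, IsL0Sublinear m ∧ ∀ q, IsL0Sublinear q → q ≤ m → m ≤ q := by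
  obtain ⟨m, hmp, hm⟩ := zorn_le_nonempty₀ (α := (E → L0 P)ᵒᵈ)
    {q | IsL0Sublinear (OrderDual.ofDual q)} (fun c hc hchain q₀ hq₀ => by
      obtain ⟨q, hq, hglb⟩ := exists_isL0Sublinear_isGLB
        (fun y => {a | ∃ r ∈ c, OrderDual.ofDual r y ≤ a})
        (fun y => ⟨_, q₀, hq₀, le_rfl⟩)
        (by
          rintro y z a ⟨r, hr, hra⟩ b ⟨s, hs, hsb⟩
          rcases hchain.total hr hs with h | h
          · exact ⟨s, hs, ((hc hs).add_le y z).trans (add_le_add ((h y).trans hra) hsb)⟩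
          · exact ⟨r, hr, ((hc hr).add_le y z).trans (add_le_add hra ((h z).trans hsb))⟩)
        (by
          rintro η hη y a ⟨r, hr, hra⟩
          exact ⟨r, hr, ((hc hr).smul_le η hη y).trans
            (mul_le_mul_of_nonneg_left hra hη.nonneg)⟩)
        (by
          rintro a ⟨r, hr, hra⟩
          exact (hc hr).map_zero.ge.trans hra)
      exact ⟨OrderDual.toDual q, hq, fun r hr y => (hglb y).1 ⟨r, hr, le_rfl⟩⟩)
    (OrderDual.toDual p) hp
  exact ⟨OrderDual.ofDual m, hmp, hm.1, fun q hq hqm => hm.2 (y := OrderDual.toDual q) hq hqm⟩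

/-- The function `x ↦ inf_{l > 0} (m (x + l y) - l m y)` is sublinear and at most `m`, so minimality
makes it equal to `m`. The term `l = 1` is the missing inequality. -/
theorem IsL0Sublinear.map_add_of_minimal [IsFiniteMeasure P] {m : E → L0 P}
    (hm : IsL0Sublinear m) (hmin : ∀ q, IsL0Sublinear q → q ≤ m → m ≤ q) (x y : E) :
    m (x + y) = m x + m y := by
  refine le_antisymm (hm.add_le x y) ?_
  obtain ⟨q, hq, hglb⟩ := exists_isL0Sublinear_isGLB
    (fun x => {a | ∃ l : L0 P, l.Pos ∧ m (x + l • y) - l * m y ≤ a})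
    (fun x => ⟨_, 1, L0.pos_one, le_rfl⟩)
    (by
      rintro u v a ⟨k, hk, hka⟩ b ⟨l, hl, hlb⟩
      refine ⟨k + l, hk.add_nonneg hl.nonneg, ?_⟩
      refine le_trans ?_ (add_le_add hka hlb)
      have h := hm.add_le (u + k • y) (v + l • y)
      rw [show u + k • y + (v + l • y) = u + v + (k + l) • y by module] at h
      calc _ ≤ m (u + k • y) + m (v + l • y) - (k + l) * m y := sub_le_sub_right h _
        _ = _ := by ring)
    (by
      rintro η hη u a ⟨l, hl, hla⟩
      refine ⟨η * l, hη.mul hl, ?_⟩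
      refine le_trans (le_of_eq ?_) (mul_le_mul_of_nonneg_left hla hη.nonneg)
      rw [mul_smul, ← smul_add, hm.map_smul hη]
      ring)
    (by
      rintro a ⟨l, hl, hla⟩
      rwa [zero_add, hm.map_smul hl, sub_self] at hla)
  have hqm : q ≤ m := fun u => (hglb u).1 ⟨1, L0.pos_one, by
    rw [one_smul, one_mul, sub_le_iff_le_add]
    exact hm.add_le u y⟩
  have h := (hmin q hq hqm x).trans ((hglb x).1 ⟨1, L0.pos_one, le_rfl⟩)
  rwa [one_smul, one_mul, le_sub_iff_add_le] at h

/-- A Hahn-Banach theorem for `L⁰`-modules: a convex cone in `E × L⁰` lies above the graph of an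
`L⁰`-linear map. -/
theorem exists_l0LinearMap_le [IsFiniteMeasure P] (T : E → Set (L0 P))
    (hne : ∀ y, (T y).Nonempty)
    (hadd : ∀ y z, ∀ a ∈ T y, ∀ b ∈ T z, a + b ∈ T (y + z))
    (hsmul : ∀ η : L0 P, η.Pos → ∀ y, ∀ a ∈ T y, η * a ∈ T (η • y))
    (hzero : ∀ a ∈ T 0, 0 ≤ a) :
    ∃ μ : E →ₗ[L0 P] L0 P, ∀ y, ∀ a ∈ T y, μ y ≤ a := by
  obtain ⟨p, hp, hpT⟩ := exists_isL0Sublinear_isGLB T hne hadd hsmul hzero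
  obtain ⟨m, hmp, hm, hmin⟩ := hp.exists_minimal
  have hma := hm.map_add_of_minimal hmin
  refine ⟨⟨⟨m, hma⟩, fun η x => ?_⟩, fun y a ha => (hmp y).trans ((hpT y).1 ha)⟩
  -- Homogeneity is known only for strictly positive scalars; `η` is the difference of the two
  -- strictly positive scalars `1 + |η| + η` and `1 + |η|`.
  have h1 : (1 + |η|).Pos := L0.pos_one.add_nonneg (abs_nonneg η)
  have h2 : (1 + (|η| + η)).Pos :=
    L0.pos_one.add_nonneg (neg_le_iff_add_nonneg.1 (neg_le_abs η))
  have h := hma (η • x) ((1 + |η|) • x)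
  rw [← add_smul, show η + (1 + |η|) = 1 + (|η| + η) by ring, hm.map_smul h1,
    hm.map_smul h2] at h
  change m (η • x) = η * m x
  rw [eq_sub_iff_add_eq.2 h.symm]
  ring

end HahnBanach

/-! ### Locality of `L⁰`-convex functions and algebraic subgradients -/

section ConvexFun

variable {Ω : Type*} [MeasurableSpace Ω] {P : Measure Ω}

namespace L0

theorem le_toBar_iff {g : L0Bar P} {a : L0 P} :
    g ≤ a.toBar ↔ ∀ᵐ ω ∂P, g ω ≤ ((a ω : ℝ) : EReal) := by
  have h : ⇑a.toBar =ᵐ[P] fun ω => ((a ω : ℝ) : EReal) :=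
    AEEqFun.coeFn_comp _ continuous_coe_real_ereal a
  rw [← AEEqFun.coeFn_le]
  refine Filter.eventually_congr ?_
  filter_upwards [h] with ω h
  rw [h]

theorem coeFn_toBar (a : L0 P) : ∀ᵐ ω ∂P, a.toBar ω = ((a ω : ℝ) : EReal) :=
  AEEqFun.coeFn_comp _ continuous_coe_real_ereal a

theorem toBar_mono {a b : L0 P} (h : a ≤ b) : a.toBar ≤ b.toBar := by
  rw [le_toBar_iff]
  filter_upwards [coeFn_toBar a, AEEqFun.coeFn_le.2 h] with ω h1 h2
  rw [h1]
  exact EReal.coe_le_coe_iff.2 h2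

theorem le_of_toBar_le {a b : L0 P} (h : a.toBar ≤ b.toBar) : a ≤ b := by
  rw [le_toBar_iff] at h
  rw [← AEEqFun.coeFn_le]
  filter_upwards [h, coeFn_toBar a] with ω h h1
  rw [h1] at h
  exact EReal.coe_le_coe_iff.1 h

theorem coeFn_ind {A : Set Ω} (hA : MeasurableSet A) :
    ∀ᵐ ω ∂P, ind P A hA ω = A.indicator (fun _ => (1 : ℝ)) ω :=
  AEEqFun.coeFn_mk _ _

theorem ind_nonneg {A : Set Ω} (hA : MeasurableSet A) : 0 ≤ ind P A hA := by
  rw [← AEEqFun.coeFn_le]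
  filter_upwards [coeFn_ind (P := P) hA, AEEqFun.coeFn_zero (μ := P) (β := ℝ)] with ω h h0
  rw [h, h0]
  exact Set.indicator_nonneg (fun _ _ => zero_le_one) ω

theorem ind_le_one {A : Set Ω} (hA : MeasurableSet A) : ind P A hA ≤ 1 := by
  rw [← AEEqFun.coeFn_le]
  filter_upwards [coeFn_ind (P := P) hA, AEEqFun.coeFn_one (μ := P) (β := ℝ)] with ω h h1
  rw [h, h1]
  exact Set.indicator_le_self' (fun _ _ => zero_le_one) ω

end L0

variable {E : Type*} [AddCommGroup E] [Module (L0 P) E] {f : E → L0Bar P}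

theorem IsL0ConvexFun.le_toBar (hf : IsL0ConvexFun f) {x y : E} {a b η : L0 P}
    (hx : f x ≤ a.toBar) (hy : f y ≤ b.toBar) (h0 : 0 ≤ η) (h1 : η ≤ 1) :
    f (η • x + (1 - η) • y) ≤ (η * a + (1 - η) * b).toBar := by
  rw [L0.le_toBar_iff] at hx hy ⊢
  filter_upwards [hf x y η h0 h1, hx, hy, AEEqFun.coeFn_le.2 h0, AEEqFun.coeFn_le.2 h1,
    AEEqFun.coeFn_zero (μ := P) (β := ℝ), AEEqFun.coeFn_one (μ := P) (β := ℝ),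
    AEEqFun.coeFn_add (η * a) ((1 - η) * b), AEEqFun.coeFn_mul η a, AEEqFun.coeFn_mul (1 - η) b,
    AEEqFun.coeFn_sub 1 η] with ω hω hx hy h0 h1 e0 e1 e2 e3 e4 e5
  rw [e0, Pi.zero_apply] at h0
  rw [e1, Pi.one_apply] at h1
  rw [e2, Pi.add_apply, e3, e4, Pi.mul_apply, Pi.mul_apply, e5, Pi.sub_apply, e1, Pi.one_apply,
    EReal.coe_add, EReal.coe_mul, EReal.coe_mul]
  exact hω.trans (add_le_add (mul_le_mul_of_nonneg_left hx (EReal.coe_nonneg.2 h0))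
    (mul_le_mul_of_nonneg_left hy (EReal.coe_nonneg.2 (sub_nonneg.2 h1))))

/-- `L⁰`-convex functions are local. -/
theorem IsL0ConvexFun.ind_le (hf : IsL0ConvexFun f) {A : Set Ω} (hA : MeasurableSet A) (x y : E) :
    ∀ᵐ ω ∂P, (ω ∈ A → f (L0.ind P A hA • x + (1 - L0.ind P A hA) • y) ω ≤ f x ω) ∧
      (ω ∉ A → f (L0.ind P A hA • x + (1 - L0.ind P A hA) • y) ω ≤ f y ω) := by
  filter_upwards [hf x y _ (L0.ind_nonneg hA) (L0.ind_le_one hA), L0.coeFn_ind (P := P) hA]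
    with ω h h1
  rw [h1] at h
  constructor <;> intro hω <;> simpa [hω] using h

/-- Sublevel sets of `L⁰`-convex functions are closed under concatenation. -/
theorem IsL0ConvexFun.le_toBar_of_isConcat (hf : IsL0ConvexFun f) {A : CountablePartition P}
    {u : ℕ → E} {x : E} (hx : IsConcat A u x) (z : E) (ε : L0 P) {a : L0 P}
    (hu : ∀ k, f (z + ε • u k) ≤ a.toBar) : f (z + ε • x) ≤ a.toBar := by
  simp only [L0.le_toBar_iff] at hu ⊢
  have key : ∀ k, ∀ᵐ ω ∂P, ω ∈ A.piece k → f (z + ε • x) ω ≤ f (z + ε • u k) ω := fun k => by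
    have h := hf.ind_le (A.measurableSet_piece k) (z + ε • u k) (z + ε • x)
    -- On the `k`-th piece `x` and `u k` agree, so gluing in `z + ε • u k` there changes nothing,
    -- and locality compares the values of `f`.
    have e : A.ind k • (z + ε • u k) + (1 - A.ind k) • (z + ε • x) = z + ε • x := by
      rw [smul_add, smul_comm, ← hx k]
      module
    rw [CountablePartition.ind] at e
    rw [e] at h
    filter_upwards [h] with ω h using h.1
  filter_upwards [ae_all_iff.2 key, ae_all_iff.2 hu, A.ae_mem_iUnion] with ω h1 h2 h3
  obtain ⟨k, hk⟩ := Set.mem_iUnion.1 h3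
  exact (h1 k hk).trans (h2 k)

variable {x₀ : E} {c : L0 P}

/-- An `L⁰`-convex function which is finite around `x₀` in every direction has an algebraic
subgradient at `x₀`. -/
theorem IsL0ConvexFun.exists_linearMap_le [IsFiniteMeasure P] (hf : IsL0ConvexFun f)
    (hc : f x₀ = c.toBar)
    (hdir : ∀ y, ∃ l : L0 P, l.Pos ∧ ∃ a : L0 P, f (x₀ + l • y) ≤ a.toBar) :
    ∃ μ : E →ₗ[L0 P] L0 P, ∀ y a, f (x₀ + y) ≤ (c + a).toBar → μ y ≤ a := by
  obtain ⟨μ, hμ⟩ := exists_l0LinearMap_le (P := P)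
    -- These are the upper bounds of some difference quotient, so the infimum over this set is the
    -- directional derivative.
    (fun y => {a | ∃ l : L0 P, l.Pos ∧ f (x₀ + l • y) ≤ (c + l * a).toBar})
    (fun y => by
      obtain ⟨l, hl, a, ha⟩ := hdir y
      obtain ⟨k, -, hk⟩ := hl.exists_inv
      refine ⟨k * (a - c), l, hl, ?_⟩
      rwa [← mul_assoc, hk, one_mul, add_sub_cancel])
    (by
      rintro y z a ⟨k, hk, ha⟩ b ⟨l, hl, hb⟩
      -- With `θ = 1 / (k + l)`, the weights `lθ` and `kθ` combine `x₀ + k y` and `x₀ + l z` into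
      -- `x₀ + klθ (y + z)`.
      obtain ⟨θ, hθ, h⟩ := (hk.add_nonneg hl.nonneg).exists_inv
      have h' : 1 - l * θ = k * θ := by
        rw [← h]
        ring
      have hnn : 0 ≤ 1 - l * θ := by
        rw [h']
        exact (hk.mul hθ).nonneg
      refine ⟨k * l * θ, (hk.mul hl).mul hθ, ?_⟩
      have := hf.le_toBar ha hb (hl.mul hθ).nonneg (sub_nonneg.1 hnn)
      convert this using 2
      · calc x₀ + (k * l * θ) • (y + z)
            = ((l * θ) + (1 - l * θ)) • x₀ + (k * l * θ) • (y + z) := by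
              rw [add_sub_cancel, one_smul]
          _ = _ := by
              rw [h']
              module
      · calc c + k * l * θ * (a + b)
            = ((l * θ) + (1 - l * θ)) * c + (k * l * θ) * (a + b) := by
              rw [add_sub_cancel, one_mul]
          _ = _ := by
              rw [h']
              ring)
    (by
      rintro η hη y a ⟨l, hl, ha⟩
      obtain ⟨θ, hθ, h⟩ := hη.exists_inv
      refine ⟨l * θ, hl.mul hθ, ?_⟩
      rwa [smul_smul, show l * θ * η = l * (η * θ) by ring,
        show l * θ * (η * a) = l * (η * θ) * a by ring, h, mul_one])
    (by
      rintro a ⟨l, hl, ha⟩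
      obtain ⟨k, hk, h⟩ := hl.exists_inv
      rw [smul_zero, add_zero, hc] at ha
      have := mul_le_mul_of_nonneg_left (le_add_iff_nonneg_right c |>.1 (L0.le_of_toBar_le ha))
        hk.nonneg
      rwa [mul_zero, ← mul_assoc, mul_comm k, h, one_mul] at this)
  exact ⟨μ, fun y a ha => hμ y a ⟨1, L0.pos_one, by rwa [one_smul, one_mul]⟩⟩

/-- Bounds in `L⁰` on `f` at finite points give the subgradient inequality at all points. -/
theorem IsL0ConvexFun.ae_le_sub (hf : IsL0ConvexFun f) (hbot : ∀ x, ∀ᵐ ω ∂P, ⊥ < f x ω)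
    (hc : f x₀ = c.toBar) {μ : E →ₗ[L0 P] L0 P}
    (hμ : ∀ y a, f (x₀ + y) ≤ (c + a).toBar → μ y ≤ a) (x : E) :
    ∀ᵐ ω ∂P, ((μ (x - x₀) ω : ℝ) : EReal) ≤ f x ω - f x₀ ω := by
  have hfm : Measurable (f x) := (AEEqFun.stronglyMeasurable (f x)).measurable
  have hA : MeasurableSet {ω | f x ω < ⊤} := measurableSet_lt hfm measurable_const
  -- The default `0` is the right bound where `f x = ⊤`: there `x` is replaced by `x₀`, whose
  -- increment is `0`.
  have hg : Measurable fun ω => if f x ω < ⊤ then (f x ω).toReal - c ω else 0 :=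
    Measurable.ite hA (hfm.ereal_toReal.sub (AEEqFun.stronglyMeasurable c).measurable)
      measurable_const
  set i := L0.ind P _ hA
  set g : L0 P := AEEqFun.mk _ hg.aestronglyMeasurable
  have hx₀ : ∀ᵐ ω ∂P, f x₀ ω = ((c ω : ℝ) : EReal) := by
    rw [hc]
    exact L0.coeFn_toBar c
  have hle : μ (i • (x - x₀)) ≤ g := hμ _ _ (by
    rw [show x₀ + i • (x - x₀) = i • x + (1 - i) • x₀ by module, L0.le_toBar_iff]
    filter_upwards [hf.ind_le hA x x₀, AEEqFun.coeFn_add c g, hx₀, hbot x,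
      AEEqFun.coeFn_mk _ hg.aestronglyMeasurable] with ω h1 h2 h3 h4 h5
    rw [h2, Pi.add_apply, h5]
    by_cases hω : f x ω < ⊤
    · rw [if_pos hω, add_sub_cancel, EReal.coe_toReal hω.ne h4.ne']
      exact h1.1 hω
    · rw [if_neg hω, add_zero, ← h3]
      exact h1.2 hω)
  rw [_root_.map_smul, smul_eq_mul] at hle
  filter_upwards [AEEqFun.coeFn_le.2 hle, AEEqFun.coeFn_mul i (μ (x - x₀)), hx₀, hbot x,
    AEEqFun.coeFn_mk _ hg.aestronglyMeasurable, L0.coeFn_ind (P := P) hA] with ω h1 h2 h3 h4 h5 h6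
  rw [h2, Pi.mul_apply, h5, h6] at h1
  rw [h3]
  by_cases hω : f x ω < ⊤
  · rw [if_pos hω, Set.indicator_of_mem (by exact hω), one_mul] at h1
    rw [← EReal.coe_toReal hω.ne h4.ne', ← EReal.coe_sub]
    exact EReal.coe_le_coe_iff.2 h1
  · rw [not_lt_top_iff.1 hω, EReal.top_sub_coe]
    exact le_top

end ConvexFun

/-! ### Barrels and continuity of the subgradient -/

section Barrel

variable {Ω : Type*} [MeasurableSpace Ω] {P : Measure Ω}
  {E : Type*} [AddCommGroup E] [Module (L0 P) E] [TopologicalSpace E]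

/-- An `L⁰`-linear map bounded on a neighbourhood of the origin is continuous. -/
theorem continuous_of_abs_le_one [ContinuousAdd E] [ContinuousSMul (L0 P) E]
    (μ : E →ₗ[L0 P] L0 P) {S : Set E} (hS : S ∈ 𝓝 (0 : E)) (h : ∀ y ∈ S, |μ y| ≤ 1) :
    Continuous μ := by
  refine continuous_def.2 fun U hU => isOpen_iff_mem_nhds.2 fun x hx => ?_
  obtain ⟨ε, hε, hεU⟩ := hU (μ x) hx
  obtain ⟨θ, hθ, he⟩ := hε.exists_inv
  -- The factor `θ + θ = 2/ε` yields `|μ z - μ x| ≤ ε/2`, which is strictly below `ε`.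
  have hcont : Continuous fun z : E => (θ + θ) • (z + -x) := by fun_prop
  have hmem := hcont.continuousAt.preimage_mem_nhds (x := x) (t := S) (by simpa using hS)
  filter_upwards [hmem] with z hz
  refine hεU _ ?_
  have hz' := h _ hz
  rw [_root_.map_smul, smul_eq_mul, ← sub_eq_add_neg, map_sub] at hz'
  have he' : ∀ᵐ ω ∂P, ε ω * θ ω = 1 := by
    filter_upwards [AEEqFun.coeFn_mul ε θ, AEEqFun.coeFn_one (μ := P) (β := ℝ)] with ω h1 h2
    rw [he, h2] at h1
    exact h1.symm
  filter_upwards [AEEqFun.coeFn_le.2 hz', AEEqFun.coeFn_abs ((θ + θ) * (μ z - μ x)),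
    AEEqFun.coeFn_mul (θ + θ) (μ z - μ x), AEEqFun.coeFn_add θ θ, AEEqFun.coeFn_abs (μ z - μ x),
    AEEqFun.coeFn_sub ε |μ z - μ x|, AEEqFun.coeFn_one (μ := P) (β := ℝ), hε, hθ, he']
    with ω h1 h2 h3 h4 h5 h6 h7 h8 h9 h10
  rw [h2, h3, Pi.mul_apply, h4, h7, Pi.add_apply, Pi.one_apply, abs_mul,
    abs_of_pos (add_pos h9 h9)] at h1
  rw [h6, Pi.sub_apply, h5]
  nlinarith [mul_le_mul_of_nonneg_left h1 h8.le]

variable {f : E → L0Bar P} {x₀ : E} {c : L0 P}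

/-- Around an interior point of its domain, `f` is finite in every direction. -/
theorem exists_pos_smul_mem_effDom (hE : IsStableLocallyL0Convex P E)
    (hx₀ : x₀ ∈ interior (effDom f)) (y : E) :
    ∃ l : L0 P, l.Pos ∧ x₀ + l • y ∈ effDom f ∧ x₀ - l • y ∈ effDom f := by
  obtain ⟨𝒰, hbasis, -, h𝒰⟩ := hE.exists_basis
  have := hE.continuousAdd
  have hcont : Continuous fun z : E => x₀ + z := by fun_prop
  have hmem := hcont.continuousAt.preimage_mem_nhds (x := 0) (t := effDom f)
    (by simpa using mem_interior_iff_mem_nhds.1 hx₀)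
  obtain ⟨U, hU, hUsub⟩ := hbasis.mem_iff.1 hmem
  obtain ⟨-, habs, hbal⟩ := h𝒰 U hU
  obtain ⟨η, hη, u, hu, rfl⟩ := habs y
  obtain ⟨l, hl, h⟩ := hη.exists_inv
  have e : l • η • u = u := by rw [smul_smul, mul_comm, h, one_smul]
  refine ⟨l, hl, ?_, ?_⟩
  · simp only [e]
    exact hUsub hu
  · simp only [e, sub_eq_add_neg]
    refine hUsub ?_
    have := hbal u hu (-1) (by rw [abs_neg, abs_of_nonneg L0.pos_one.nonneg])
    rwa [neg_one_smul] at this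

theorem isClosed_le_smul [ContinuousAdd E] [ContinuousSMul (L0 P) E]
    (hlsc : IsL0LowerSemicontinuous f) (ε : L0 P) (b : L0Bar P) :
    IsClosed {y | f (x₀ + ε • y) ≤ b} :=
  (hlsc b).preimage (f := fun y : E => x₀ + ε • y) (by fun_prop)

/-- The symmetric sublevel set of `f` at an interior point of its domain is a neighbourhood
of the origin. -/
theorem IsL0ConvexFun.symmetric_sublevel_mem_nhds (hE : IsStableLocallyL0Convex P E)
    (hbar : IsStablyBarreled P E) (hlsc : IsL0LowerSemicontinuous f) (hf : IsL0ConvexFun f)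
    (hc : f x₀ = c.toBar) (hx₀ : x₀ ∈ interior (effDom f)) :
    {y | ∀ ε : L0 P, ε = 1 ∨ ε = -1 → f (x₀ + ε • y) ≤ (c + 1).toBar} ∈ 𝓝 (0 : E) := by
  have := hE.continuousAdd
  have := hE.continuousSMul
  have hconv : IsL0Convex P
      {y | ∀ ε : L0 P, ε = 1 ∨ ε = -1 → f (x₀ + ε • y) ≤ (c + 1).toBar} := by
    intro y hy z hz η h0 h1 ε hε
    convert hf.le_toBar (hy ε hε) (hz ε hε) h0 h1 using 2
    · module
    · ring
  have hneg : ∀ y ∈ {y | ∀ ε : L0 P, ε = 1 ∨ ε = -1 → f (x₀ + ε • y) ≤ (c + 1).toBar},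
      -y ∈ {y | ∀ ε : L0 P, ε = 1 ∨ ε = -1 → f (x₀ + ε • y) ≤ (c + 1).toBar} := by
    intro y hy ε hε
    rw [smul_neg, ← neg_smul]
    refine hy _ ?_
    rcases hε with rfl | rfl <;> simp
  refine hbar _ ⟨⟨0, fun ε _ => ?_⟩, fun A u hu x hx ε hε =>
    hf.le_toBar_of_isConcat hx x₀ ε fun k => hu k ε hε⟩ ⟨hconv, fun y => ?_, fun y hy η hη => ?_, ?_⟩
  · rw [smul_zero, add_zero, hc]
    exact L0.toBar_mono (le_add_of_nonneg_right L0.pos_one.nonneg)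
  · obtain ⟨l, hl, ⟨a, ha⟩, b, hb⟩ := exists_pos_smul_mem_effDom hE hx₀ y
    obtain ⟨k, hk, hlk⟩ := hl.exists_inv
    -- Shrinking the step by `δ = 1 / (1 + |a - c| + |b - c|)` brings the increment of `f` below `1`
    -- in both directions, by convexity between `x₀` and `x₀ ± l y`.
    have hD : (1 + (|a - c| + |b - c|)).Pos :=
      L0.pos_one.add_nonneg (add_nonneg (abs_nonneg _) (abs_nonneg _))
    obtain ⟨δ, hδ, hDδ⟩ := hD.exists_inv
    have hδ1 : δ ≤ 1 := by
      rw [← hDδ]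
      refine le_mul_of_one_le_left hδ.nonneg ?_
      exact le_add_of_nonneg_right (add_nonneg (abs_nonneg _) (abs_nonneg _))
    have hbound : ∀ (ε d : L0 P), f (x₀ + ε • l • y) = d.toBar → |d - c| ≤ |a - c| + |b - c| →
        f (x₀ + ε • δ • l • y) ≤ (c + 1).toBar := by
      intro ε d hd hdle
      have h := hf.le_toBar hd.le hc.le hδ.nonneg hδ1
      rw [show δ • (x₀ + ε • l • y) + (1 - δ) • x₀ = x₀ + ε • δ • l • y by module,
        show δ * d + (1 - δ) * c = c + (d - c) * δ by ring] at h
      refine h.trans (L0.toBar_mono (add_le_add_right ?_ c))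
      rw [← hDδ]
      refine mul_le_mul_of_nonneg_right ((le_abs_self _).trans (hdle.trans ?_)) hδ.nonneg
      exact le_add_of_nonneg_left L0.pos_one.nonneg
    refine ⟨k * (1 + (|a - c| + |b - c|)), hk.mul hD, δ • l • y, ?_, ?_⟩
    · rintro ε (rfl | rfl)
      · exact hbound 1 a (by rwa [one_smul]) (le_add_of_nonneg_right (abs_nonneg _))
      · exact hbound (-1) b (by rwa [neg_one_smul, ← sub_eq_add_neg])
          (le_add_of_nonneg_left (abs_nonneg _))
    · change (k * (1 + (|a - c| + |b - c|))) • δ • l • y = y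
      rw [smul_smul, smul_smul, show k * (1 + (|a - c| + |b - c|)) * δ * l
        = (l * k) * ((1 + (|a - c| + |b - c|)) * δ) by ring, hlk, hDδ, one_mul, one_smul]
  -- With `h = 1/2`, `η y` is the convex combination of `y` and `-y` with weights `(1 + η)/2` and
  -- `(1 - η)/2`.
  · obtain ⟨h, hh, h2⟩ := (L0.pos_one (P := P)).add_nonneg L0.pos_one.nonneg |>.exists_inv
    have hη' : -1 ≤ η := neg_le.1 ((neg_le_abs η).trans hη)
    have hη'' : η ≤ 1 := (le_abs_self η).trans hη
    have e : 1 - h * (1 + η) = h * (1 - η) := by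
      linear_combination -h2
    have key := hconv y hy (-y) (hneg y hy) (h * (1 + η))
      (mul_nonneg hh.nonneg (neg_le_iff_add_nonneg'.1 hη'))
      (sub_nonneg.1 (by
        rw [e]
        exact mul_nonneg hh.nonneg (sub_nonneg.2 hη'')))
    rw [e, show (h * (1 + η)) • y + (h * (1 - η)) • -y = (((1 + 1) * h) * η) • y by module, h2,
      one_mul] at key
    exact key
  · simp only [Set.ofPred_forall]
    exact isClosed_iInter fun ε => isClosed_iInter fun _ => isClosed_le_smul hlsc ε _

end Barrel

theorem mainTheorem6 {Ω : Type*} [MeasurableSpace Ω] (P : Measure Ω) [IsProbabilityMeasure P]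
    {E : Type*} [AddCommGroup E] [Module (L0 P) E] [TopologicalSpace E]
    (hE : IsStableLocallyL0Convex P E) (hbar : IsStablyBarreled P E)
    (f : E → L0Bar P) (hproper : IsProperFun f) (hlsc : IsL0LowerSemicontinuous f)
    (hconv : IsL0ConvexFun f) :
    ∀ x ∈ interior (effDom f), (l0Subdifferential f x).Nonempty := by
  intro x₀ hx₀
  have := hE.continuousAdd
  have := hE.continuousSMul
  obtain ⟨c, hc⟩ := interior_subset hx₀
  obtain ⟨μ, hμ⟩ := hconv.exists_linearMap_le hc fun y => by
    obtain ⟨l, hl, ⟨a, ha⟩, -⟩ := exists_pos_smul_mem_effDom hE hx₀ y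
    exact ⟨l, hl, a, ha.le⟩
  have hcont : Continuous μ := by
    refine continuous_of_abs_le_one μ
      (hconv.symmetric_sublevel_mem_nhds hE hbar hlsc hc hx₀) fun y hy => ?_
    refine sup_le (hμ _ _ ?_) ?_
    · simpa using hy 1 (Or.inl rfl)
    · rw [← map_neg]
      refine hμ _ _ ?_
      simpa using hy (-1) (Or.inr rfl)
  exact ⟨⟨μ, hcont⟩, ⟨c, hc⟩, hconv.ae_le_sub hproper.1 hc hμ⟩
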